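/- Let $T$ be a rooted tree with $n \ge 2$ nodes, labelled $1,\dots,n$, and let $\mathcal C(i)$ denote the set of children of node $i$. Let $$\mathcal F(T) = \Bigl\{\mu\in\mathbb R^n : \mu_i \ge \sum_{j\in\mathcal C(i)} \mu_j \text{ for all } i=1,\dots,n\Bigr\}$$ be the cone of flows on $T$ (an empty sum is $0$, so $\mu_i\ge 0$ at the leaves, i.e. the nodes without children), and let $h$ be the height of $T$, that is, the maximum graph distance (number of edges) from the root to a leaf. For $\mu\in\mathcal F(T)$ one observes $Y_i=\mu_i+\epsilon_i$, $i=1,\dots,n$, where the $\epsilon_i$ are independent $N(0,\sigma^2)$ random variables and $\sigma \ge 0$. Let $$\hat\mu = \operatorname*{argmin}_{f\in\mathcal F(T)} \sum_{i=1}^n (Y_i-f_i)^2$$ be the least squares estimator. Then there is a universal constant $C>0$ (depending on none of $n$, $T$, $h$, $\sigma$, $V$) such that for every such $T$, every $\sigma\ge 0$ and every $V\ge 0$, $$\sup_{\mu\in\mathcal F(T):\ \mu_{\mathrm{root}}\le V} \mathbb E\,\frac1n\|\hat\mu-\mu\|^2 \;\le\; \frac{C}{n}\Bigl(\sigma^2h^2\log\bigl(\tfrac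 nh\bigr)+hV\sigma\sqrt{\log\bigl(\tfrac nh\bigr)}\Bigr),$$ where $\|\cdot\|$ is the Euclidean norm on $\mathbb R^n$. -/

import Mathlib

open MeasureTheory ProbabilityTheory
open scoped BigOperators ENNReal

namespace TreeFlow

/-- A rooted tree on the nodes `0, …, n - 1`: a graph-theoretic tree with a marked node. -/
structure RootedTree (n : ℕ) where
  graph : SimpleGraph (Fin n)
  isTree : graph.IsTree
  root : Fin n

namespace RootedTree

variable {n : ℕ}

/-- The graph distance of a node from the root. -/
noncomputable def depth (T : RootedTree n) (i : Fin n) : ℕ := T.graph.dist T.root i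

open Classical in
/-- The children of `i`: the neighbours of `i` one step further away from the root. -/
noncomputable def children (T : RootedTree n) (i : Fin n) : Finset (Fin n) :=
  {j | T.graph.Adj i j ∧ T.depth j = T.depth i + 1}

open Classical in
/-- The leaves: the nodes without children. -/
noncomputable def leaves (T : RootedTree n) : Finset (Fin n) := {i | T.children i = ∅}

/-- The height: the maximum graph distance from the root to a leaf (counted in edges). -/
noncomputable def height (T : RootedTree n) : ℕ := T.leaves.sup T.depth

/-- The cone of flows `F(T)`: vectors `μ ∈ ℝⁿ` with `μ i ≥ ∑ μ j` over the children `j` of `i`,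
for every node `i`; an empty sum is `0`, so leaves carry non-negative values. -/
def flows (T : RootedTree n) : Set (EuclideanSpace ℝ (Fin n)) :=
  {μ | ∀ i, ∑ j ∈ T.children i, μ j ≤ μ i}

theorem zero_mem_flows (T : RootedTree n) : (0 : EuclideanSpace ℝ (Fin n)) ∈ T.flows := by
  intro i
  simp

theorem isClosed_flows (T : RootedTree n) : IsClosed T.flows := by
  have h : T.flows = ⋂ i, {μ : EuclideanSpace ℝ (Fin n) | ∑ j ∈ T.children i, μ j ≤ μ i} := by
    ext μ
    simp [flows]
  rw [h]
  exact isClosed_iInter fun i => isClosed_le (by fun_prop) (by fun_prop)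

theorem convex_flows (T : RootedTree n) : Convex ℝ T.flows := by
  intro μ hμ ν hν a b ha hb _ i
  have h1 := mul_le_mul_of_nonneg_left (hμ i) ha
  have h2 := mul_le_mul_of_nonneg_left (hν i) hb
  simp only [PiLp.add_apply, PiLp.smul_apply, smul_eq_mul, Finset.sum_add_distrib,
    ← Finset.mul_sum]
  linarith

/-- `f` minimizes the residual sum of squares for the data `y` over the cone of flows. -/
def IsLeastSquares (T : RootedTree n) (y f : EuclideanSpace ℝ (Fin n)) : Prop :=
  f ∈ T.flows ∧ ∀ g ∈ T.flows, ∑ i, (y i - f i) ^ 2 ≤ ∑ i, (y i - g i) ^ 2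

theorem existsUnique_isLeastSquares (T : RootedTree n) (y : EuclideanSpace ℝ (Fin n)) :
    ∃! f, T.IsLeastSquares y f := by
  have key : ∀ g : EuclideanSpace ℝ (Fin n), ∑ i, (y i - g i) ^ 2 = dist y g ^ 2 := by
    intro g
    rw [EuclideanSpace.dist_eq, Real.sq_sqrt (Finset.sum_nonneg fun i _ => sq_nonneg _)]
    exact Finset.sum_congr rfl fun i _ => by rw [Real.dist_eq, sq_abs]
  obtain ⟨f, hf, hd⟩ := T.isClosed_flows.exists_infDist_eq_dist ⟨0, T.zero_mem_flows⟩ y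
  refine ⟨f, ⟨hf, fun g hg => ?_⟩, ?_⟩
  · rw [key, key, ← hd]
    have := Metric.infDist_le_dist_of_mem (x := y) hg
    have h0 := Metric.infDist_nonneg (x := y) (s := T.flows)
    gcongr
  · rintro g ⟨hg, hgm⟩
    have hm : (1 / 2 : ℝ) • f + (1 / 2 : ℝ) • g ∈ T.flows :=
      T.convex_flows hf hg (by norm_num) (by norm_num) (by norm_num)
    have h1 := hgm _ hm
    have h2 := hgm f hf
    have h4 : ∑ i, (y i - ((1 / 2 : ℝ) • f + (1 / 2 : ℝ) • g) i) ^ 2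
        = (∑ i, (y i - f i) ^ 2) / 2 + (∑ i, (y i - g i) ^ 2) / 2
          - (∑ i, (f i - g i) ^ 2) / 4 := by
      rw [Finset.sum_div, Finset.sum_div, Finset.sum_div, ← Finset.sum_add_distrib,
        ← Finset.sum_sub_distrib]
      refine Finset.sum_congr rfl fun i _ => ?_
      simp only [PiLp.add_apply, PiLp.smul_apply, smul_eq_mul]
      ring
    have h3 : ∑ i, (y i - f i) ^ 2 ≤ ∑ i, (y i - g i) ^ 2 := by
      rw [key, key, ← hd]
      have := Metric.infDist_le_dist_of_mem (x := y) hg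
      have h0 := Metric.infDist_nonneg (x := y) (s := T.flows)
      gcongr
    have h5 : ∑ i, (f i - g i) ^ 2 = 0 :=
      le_antisymm (by linarith) (Finset.sum_nonneg fun i _ => sq_nonneg _)
    rw [Finset.sum_eq_zero_iff_of_nonneg (fun i _ => sq_nonneg _)] at h5
    ext i
    have := pow_eq_zero_iff (two_ne_zero) |>.1 (h5 i (Finset.mem_univ i))
    linarith

/-- The least squares estimator: the unique minimizer of `∑ i, (y i - f i) ^ 2` over flows `f`. -/
noncomputable def lse (T : RootedTree n) (y : EuclideanSpace ℝ (Fin n)) :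
    EuclideanSpace ℝ (Fin n) :=
  (T.existsUnique_isLeastSquares y).choose

theorem lse_spec (T : RootedTree n) (y : EuclideanSpace ℝ (Fin n)) :
    T.IsLeastSquares y (T.lse y) :=
  (T.existsUnique_isLeastSquares y).choose_spec.1

end RootedTree

/-- The law of `n` independent errors, each distributed as `N(0, σ²)`. -/
noncomputable def noise (n : ℕ) (σ : ℝ) : Measure (Fin n → ℝ) :=
  Measure.pi fun _ => gaussianReal 0 (Real.toNNReal (σ ^ 2))

/-- The risk `E (1/n) ‖est Y - μ‖²` of an estimator `est`, where `Y = μ + ε` and the errors `ε`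
are independent and `N(0, σ²)`-distributed. The expectation of this non-negative quantity is
taken in `[0, ∞]`. -/
noncomputable def risk {n : ℕ} (σ : ℝ)
    (est : EuclideanSpace ℝ (Fin n) → EuclideanSpace ℝ (Fin n))
    (μ : EuclideanSpace ℝ (Fin n)) : ℝ≥0∞ :=
  ∫⁻ ε, ENNReal.ofReal ((1 / n : ℝ) * ‖est (μ + WithLp.toLp 2 ε) - μ‖ ^ 2) ∂(noise n σ)

end TreeFlow

/-! A flow `f` has excesses `f j - ∑ i ∈ T.children j, f i`, which are nonnegative and sum to `f
T.root`. Summation by parts (`sum_mul_eq_sum_pathSum`) writes an inner product with noise `e` as the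
excess-weighted sum of root-to-node path sums of `e`, so it is at most `M * f T.root`, with `M` the
largest absolute path sum. Convexity gives `‖d‖² ≤ ⟨e, d⟩` for the error `d`; hence `‖d‖² ≤ 4VM +
M²`. Path sums are Gaussian with variance at most `(h + 1)σ²`, and an exponential-moment union bound
gives `E M² ≤ 16hσ² log n`. To replace `log n` by `log (n / h)`: if `h² ≤ n` the two logarithms are
comparable; if `n ≤ h²` the crude bound `E ‖d‖² ≤ nσ²` is already small enough. -/

namespace TreeFlow

/-! ### Parents, depth and height -/

namespace RootedTree

variable {n : ℕ}

theorem depth_root (T : RootedTree n) : T.depth T.root = 0 := by simp [depth]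

theorem mem_children {T : RootedTree n} {i j : Fin n} :
    j ∈ T.children i ↔ T.graph.Adj i j ∧ T.depth j = T.depth i + 1 := by
  simp [children]

/-- Every node other than the root has a parent. -/
theorem exists_parent (T : RootedTree n) {i : Fin n} (hi : i ≠ T.root) :
    ∃ j, i ∈ T.children j := by
  obtain ⟨p, hp, hl⟩ := (T.isTree.connected T.root i).exists_path_of_dist
  have hnil : ¬ p.Nil := fun h => hi h.eq.symm
  refine ⟨p.penultimate, mem_children.2 ⟨p.adj_penultimate hnil, ?_⟩⟩
  have h1 : T.graph.dist T.root p.penultimate ≤ p.dropLast.length := SimpleGraph.dist_le _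
  have h2 : p.dropLast.length + 1 = p.length := by
    rw [SimpleGraph.Walk.length_dropLast_add_one hnil]
  have h3 := T.isTree.dist_eq_dist_add_one_of_adj T.root (p.adj_penultimate hnil)
  simp only [depth]
  omega

/-- A node has at most one parent. -/
theorem parent_unique (T : RootedTree n) {i j k : Fin n} (hj : i ∈ T.children j)
    (hk : i ∈ T.children k) : j = k := by
  rw [mem_children] at hj hk
  -- A shortest path to a parent extends to a shortest path to `i`; paths in a tree are unique.
  have key : ∀ l, T.graph.Adj l i → T.depth i = T.depth l + 1 →
      ∃ p : T.graph.Walk T.root i, p.IsPath ∧ p.penultimate = l := by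
    intro l hl hd
    obtain ⟨p, hp, hlen⟩ := (T.isTree.connected T.root l).exists_path_of_dist
    refine ⟨p.concat hl, ?_, by simp⟩
    apply SimpleGraph.Walk.isPath_of_length_eq_dist
    simp only [SimpleGraph.Walk.length_concat, hlen]
    exact hd.symm
  obtain ⟨p, hp, rfl⟩ := key j hj.1 hj.2
  obtain ⟨q, hq, rfl⟩ := key k hk.1 hk.2
  rw [(T.isTree.existsUnique_path T.root i).unique hp hq]

/-- The height only ranges over leaves, but a node of maximal depth is a leaf. -/
theorem depth_le_height (T : RootedTree n) (i : Fin n) : T.depth i ≤ T.height := by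
  have : Nonempty (Fin n) := ⟨i⟩
  obtain ⟨m, hm⟩ := Finite.exists_max T.depth
  refine (hm i).trans (Finset.le_sup (f := T.depth) ?_)
  simp only [leaves, Finset.mem_filter, Finset.mem_univ, true_and]
  refine Finset.eq_empty_of_forall_notMem fun j hj => ?_
  have := (mem_children.1 hj).2
  have := hm j
  omega

theorem height_pos (T : RootedTree n) (hn : 2 ≤ n) : 1 ≤ T.height := by
  have : Nontrivial (Fin n) := Fin.nontrivial_iff_two_le.2 hn
  obtain ⟨i, hi⟩ := exists_ne T.root
  obtain ⟨j, hj⟩ := T.exists_parent hi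
  have := T.depth_le_height i
  have := (mem_children.1 hj).2
  omega

theorem height_lt (T : RootedTree n) : T.height < n := by
  have hn : 0 < n := T.root.pos
  rw [height, Finset.sup_lt_iff hn]
  intro i _
  obtain ⟨p, hp, hl⟩ := (T.isTree.connected T.root i).exists_path_of_dist
  have := hp.length_lt
  rw [Fintype.card_fin] at this
  rw [depth, ← hl]
  exact this

/-! ### Root-to-node paths -/

open Classical in
/-- The parent of a node; the root is its own parent. -/
noncomputable def parent (T : RootedTree n) (i : Fin n) : Fin n :=
  if h : i = T.root then i else (T.exists_parent h).choose

theorem parent_root (T : RootedTree n) : T.parent T.root = T.root := by simp [parent]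

theorem mem_children_parent (T : RootedTree n) {i : Fin n} (hi : i ≠ T.root) :
    i ∈ T.children (T.parent i) := by
  rw [parent, dif_neg hi]
  exact (T.exists_parent hi).choose_spec

theorem mem_children_iff (T : RootedTree n) {i j : Fin n} :
    i ∈ T.children j ↔ i ≠ T.root ∧ T.parent i = j := by
  constructor
  · intro h
    have hi : i ≠ T.root := by
      rintro rfl
      have := (mem_children.1 h).2
      rw [depth_root] at this
      omega
    exact ⟨hi, T.parent_unique (T.mem_children_parent hi) h⟩
  · rintro ⟨hi, rfl⟩
    exact T.mem_children_parent hi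

theorem depth_parent (T : RootedTree n) {i : Fin n} (hi : i ≠ T.root) :
    T.depth i = T.depth (T.parent i) + 1 :=
  (mem_children.1 (T.mem_children_parent hi)).2

theorem depth_iterate_parent_le (T : RootedTree n) (k : ℕ) (i : Fin n) :
    T.depth (T.parent^[k] i) ≤ T.depth i := by
  induction k with
  | zero => simp
  | succ k ih =>
    rw [Function.iterate_succ_apply']
    by_cases h : T.parent^[k] i = T.root
    · rw [h, parent_root, depth_root]
      exact Nat.zero_le _
    · have := T.depth_parent h
      omega

open Classical in
/-- The nodes on the path from the root to `i`, both ends included. -/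
noncomputable def ancestors (T : RootedTree n) (i : Fin n) : Finset (Fin n) :=
  {j | ∃ k, T.parent^[k] i = j}

theorem mem_ancestors {T : RootedTree n} {i j : Fin n} :
    j ∈ T.ancestors i ↔ ∃ k, T.parent^[k] i = j := by
  simp [ancestors]

theorem ancestors_root (T : RootedTree n) : T.ancestors T.root = {T.root} := by
  ext j
  simp [mem_ancestors, Function.iterate_fixed T.parent_root, eq_comm]

theorem ancestors_eq_insert (T : RootedTree n) (i : Fin n) :
    T.ancestors i = insert i (T.ancestors (T.parent i)) := by
  ext j
  simp only [mem_ancestors, Finset.mem_insert]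
  constructor
  · rintro ⟨k, hk⟩
    cases k with
    | zero => exact Or.inl hk.symm
    | succ k => exact Or.inr ⟨k, hk⟩
  · rintro (rfl | ⟨k, hk⟩)
    · exact ⟨0, rfl⟩
    · exact ⟨k + 1, hk⟩

theorem notMem_ancestors_parent (T : RootedTree n) {i : Fin n} (hi : i ≠ T.root) :
    i ∉ T.ancestors (T.parent i) := by
  rw [mem_ancestors]
  rintro ⟨k, hk⟩
  have h1 := T.depth_iterate_parent_le k (T.parent i)
  have h2 := T.depth_parent hi
  rw [hk] at h1
  omega

theorem card_ancestors (T : RootedTree n) (i : Fin n) :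
    (T.ancestors i).card = T.depth i + 1 := by
  generalize hd : T.depth i = d
  induction d generalizing i with
  | zero =>
    have : i = T.root := by
      by_contra h
      have := T.depth_parent h
      omega
    rw [this, ancestors_root, Finset.card_singleton]
  | succ d ih =>
    have hi : i ≠ T.root := by
      rintro rfl
      rw [depth_root] at hd
      omega
    have := T.depth_parent hi
    rw [ancestors_eq_insert, Finset.card_insert_of_notMem (T.notMem_ancestors_parent hi),
      ih _ (by omega)]

/-! ### Path sums as dual to flows -/

/-- Summation by parts over the tree. -/
theorem sum_mul_sub_sum_children (T : RootedTree n) (S f : Fin n → ℝ) :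
    ∑ j, S j * (f j - ∑ i ∈ T.children j, f i) =
      S T.root * f T.root + ∑ i with i ≠ T.root, (S i - S (T.parent i)) * f i := by
  have h1 : ∑ j, S j * ∑ i ∈ T.children j, f i =
      ∑ i with i ≠ T.root, S (T.parent i) * f i := by
    rw [← Finset.sum_fiberwise ({i | i ≠ T.root} : Finset (Fin n)) T.parent]
    refine Finset.sum_congr rfl fun j _ => ?_
    have : ({i ∈ ({i | i ≠ T.root} : Finset (Fin n)) | T.parent i = j}) = T.children j := by
      ext i
      simp [mem_children_iff]
    rw [this, Finset.mul_sum]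
    refine Finset.sum_congr rfl fun i hi => ?_
    rw [(T.mem_children_iff.1 hi).2]
  have h2 : ∑ j, S j * f j = S T.root * f T.root + ∑ i with i ≠ T.root, S i * f i := by
    rw [Finset.filter_ne',
      Finset.add_sum_erase _ (fun i => S i * f i) (Finset.mem_univ T.root)]
  simp only [mul_sub, sub_mul, Finset.sum_sub_distrib, h1, h2]
  ring

/-- The sum of the entries of `e` on the path from the root to `i`. -/
noncomputable def pathSum (T : RootedTree n) (e : Fin n → ℝ) (i : Fin n) : ℝ :=
  ∑ j ∈ T.ancestors i, e j

/-- The path sum increases by exactly `e i` from the parent of `i` to `i`. -/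
theorem sum_mul_eq_sum_pathSum (T : RootedTree n) (e f : Fin n → ℝ) :
    ∑ i, e i * f i = ∑ j, T.pathSum e j * (f j - ∑ i ∈ T.children j, f i) := by
  rw [sum_mul_sub_sum_children, ← Finset.add_sum_erase _ _ (Finset.mem_univ T.root),
    ← Finset.filter_ne']
  congr 1
  · simp [pathSum, ancestors_root]
  · refine Finset.sum_congr rfl fun i hi => ?_
    have hi : i ≠ T.root := by simpa using hi
    rw [pathSum, ancestors_eq_insert, Finset.sum_insert (T.notMem_ancestors_parent hi), pathSum]
    ring

theorem sum_sub_sum_children (T : RootedTree n) (f : Fin n → ℝ) :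
    ∑ j, (f j - ∑ i ∈ T.children j, f i) = f T.root := by
  simpa using T.sum_mul_sub_sum_children (fun _ => 1) f

/-- Inner products with a flow are controlled by the path sums. -/
theorem abs_sum_mul_le (T : RootedTree n) {f : EuclideanSpace ℝ (Fin n)} (hf : f ∈ T.flows)
    (e : Fin n → ℝ) {M : ℝ} (hM : ∀ i, |T.pathSum e i| ≤ M) :
    |∑ i, e i * f i| ≤ M * f T.root := by
  rw [T.sum_mul_eq_sum_pathSum e f, ← T.sum_sub_sum_children f, Finset.mul_sum]
  refine (Finset.abs_sum_le_sum_abs _ _).trans (Finset.sum_le_sum fun j _ => ?_)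
  have h := sub_nonneg.2 (hf j)
  rw [abs_mul, abs_of_nonneg h]
  exact mul_le_mul_of_nonneg_right (hM j) h

/-! ### Deterministic error bounds -/

/-- The basic inequality for the least squares estimator over a convex set. -/
theorem norm_sq_lse_sub_le (T : RootedTree n) {μ : EuclideanSpace ℝ (Fin n)} (hμ : μ ∈ T.flows)
    (e : Fin n → ℝ) :
    ‖T.lse (μ + WithLp.toLp 2 e) - μ‖ ^ 2 ≤
      ∑ i, e i * (T.lse (μ + WithLp.toLp 2 e) - μ) i := by
  set f := T.lse (μ + WithLp.toLp 2 e) with hfdef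
  obtain ⟨hf, hmin⟩ := T.lse_spec (μ + WithLp.toLp 2 e)
  rw [← hfdef] at hf hmin
  set A := ∑ i, e i * (f - μ) i with hA
  set B := ‖f - μ‖ ^ 2 with hB
  have hB' : B = ∑ i, (f i - μ i) ^ 2 := by
    rw [hB, EuclideanSpace.norm_sq_eq]
    exact Finset.sum_congr rfl fun i _ => by simp
  -- Optimality of `f` against the segment from `f` to `μ`; the claim is the limit `t → 0`.
  have key : ∀ t : ℝ, 0 < t → t ≤ 1 → 0 ≤ 2 * (A - B) + t * B := by
    intro t ht ht1
    have h := hmin _ (T.convex_flows hf hμ (sub_nonneg.2 ht1) ht.le (by ring))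
    have h2 : ∑ i, ((μ + WithLp.toLp 2 e) i - ((1 - t) • f + t • μ) i) ^ 2 =
        ∑ i, ((μ + WithLp.toLp 2 e) i - f i) ^ 2 + t * (2 * (A - B) + t * B) := by
      rw [hB', hA, ← Finset.sum_sub_distrib, Finset.mul_sum, Finset.mul_sum,
        ← Finset.sum_add_distrib, Finset.mul_sum, ← Finset.sum_add_distrib]
      refine Finset.sum_congr rfl fun i _ => ?_
      simp only [PiLp.add_apply, PiLp.smul_apply, PiLp.sub_apply, smul_eq_mul]
      ring
    rw [h2] at h
    exact nonneg_of_mul_nonneg_right (by linarith) ht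
  by_contra! hlt
  have hB0 : 0 ≤ B := sq_nonneg _
  -- This `t` satisfies `t * B ≤ B - A`, which contradicts `key` when `A < B`.
  have h1 := key (min 1 ((B - A) / (B + 1))) (lt_min one_pos (by apply div_pos <;> linarith))
    (min_le_left _ _)
  have h2 : min 1 ((B - A) / (B + 1)) * B ≤ B - A := by
    calc _ ≤ (B - A) / (B + 1) * B := mul_le_mul_of_nonneg_right (min_le_right _ _) hB0
      _ ≤ (B - A) / (B + 1) * (B + 1) :=
        mul_le_mul_of_nonneg_left (by linarith) (div_nonneg (by linarith) (by linarith))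
      _ = B - A := div_mul_cancel₀ _ (by linarith)
  linarith

theorem norm_sq_lse_sub_le_sum_sq (T : RootedTree n) {μ : EuclideanSpace ℝ (Fin n)}
    (hμ : μ ∈ T.flows) (e : Fin n → ℝ) :
    ‖T.lse (μ + WithLp.toLp 2 e) - μ‖ ^ 2 ≤ ∑ i, e i ^ 2 := by
  have h := T.norm_sq_lse_sub_le hμ e
  set d := T.lse (μ + WithLp.toLp 2 e) - μ
  have hd : ‖d‖ ^ 2 = ∑ i, d i ^ 2 := by
    rw [EuclideanSpace.norm_sq_eq]
    exact Finset.sum_congr rfl fun i _ => by simp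
  have h2 : 2 * ∑ i, e i * d i ≤ ∑ i, e i ^ 2 + ∑ i, d i ^ 2 := by
    rw [Finset.mul_sum, ← Finset.sum_add_distrib]
    exact Finset.sum_le_sum fun i _ => by nlinarith [sq_nonneg (e i - d i)]
  linarith

/-- The root value of the estimator is at most `V + ‖d‖`, so `‖d‖² ≤ M(2V + ‖d‖)`; the term `M‖d‖`
is absorbed by `(M² + ‖d‖²) / 2`. -/
theorem norm_sq_lse_sub_le_of_pathSum (T : RootedTree n) {μ : EuclideanSpace ℝ (Fin n)}
    (hμ : μ ∈ T.flows) {V : ℝ} (hV : μ T.root ≤ V) (e : Fin n → ℝ) {M : ℝ}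
    (hM : ∀ i, |T.pathSum e i| ≤ M) :
    ‖T.lse (μ + WithLp.toLp 2 e) - μ‖ ^ 2 ≤ 4 * V * M + M ^ 2 := by
  have h := T.norm_sq_lse_sub_le hμ e
  have hf := (T.lse_spec (μ + WithLp.toLp 2 e)).1
  set f := T.lse (μ + WithLp.toLp 2 e)
  have hM0 : 0 ≤ M := (abs_nonneg _).trans (hM T.root)
  have h1 := (abs_le.1 (T.abs_sum_mul_le hf e hM)).2
  have h2 := (abs_le.1 (T.abs_sum_mul_le hμ e hM)).1
  have h3 : f T.root - μ T.root ≤ ‖f - μ‖ :=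
    (le_abs_self _).trans (PiLp.norm_apply_le (f - μ) T.root)
  have h4 : ∑ i, e i * (f - μ) i = ∑ i, e i * f i - ∑ i, e i * μ i := by
    rw [← Finset.sum_sub_distrib]
    exact Finset.sum_congr rfl fun i _ => by rw [PiLp.sub_apply]; ring
  have h5 : M * f T.root + M * μ T.root ≤ M * (2 * V + ‖f - μ‖) := by
    rw [← mul_add]
    exact mul_le_mul_of_nonneg_left (by linarith) hM0
  nlinarith [sq_nonneg (‖f - μ‖ - M)]

end RootedTree

end TreeFlow

/-! ### Gaussian moments and the maximal path sum -/

namespace TreeFlow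

open scoped NNReal

instance {n : ℕ} {σ : ℝ} : IsProbabilityMeasure (noise n σ) := by
  unfold noise
  infer_instance

theorem map_sum_pi_gaussianReal {ι : Type*} [Fintype ι] (v : ℝ≥0) (A : Finset ι) :
    (Measure.pi fun _ : ι => gaussianReal 0 v).map (fun e => ∑ j ∈ A, e j) =
      gaussianReal 0 (A.card * v) := by
  classical
  induction A using Finset.induction_on with
  | empty => simp [Measure.map_const]
  | insert a A ha ih =>
    have hind : iIndepFun (fun (i : ι) (e : ι → ℝ) => e i)
        (Measure.pi fun _ : ι => gaussianReal 0 v) :=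
      iIndepFun_pi (X := fun _ x => x) (fun _ => aemeasurable_id)
    have h1 := hind.indepFun_finsetSum_of_notMem (fun i => measurable_pi_apply i) ha
    have h2 := gaussianReal_add_gaussianReal_of_indepFun (m₁ := 0) (m₂ := 0) (v₁ := A.card * v)
      (v₂ := v) h1 (by rw [← ih]; congr 1; ext e; simp) (measurePreserving_eval _ a).map_eq
    rw [Finset.card_insert_of_notMem ha]
    convert h2 using 2
    · ext e
      simp [Finset.sum_insert ha, add_comm]
    · simp
    · push_cast; ring

/-- The integrand times the `N(0, v)` density is `√2` times the `N(0, 2v)` density. -/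
theorem lintegral_exp_sq_gaussianReal {v : ℝ≥0} (hv : v ≠ 0) :
    ∫⁻ x, ENNReal.ofReal (Real.exp (x ^ 2 / (4 * v))) ∂(gaussianReal 0 v) =
      ENNReal.ofReal (Real.sqrt 2) := by
  have hv0 : (0 : ℝ) < v := by positivity
  rw [gaussianReal_of_var_ne_zero _ hv,
    lintegral_withDensity_eq_lintegral_mul _ (measurable_gaussianPDF 0 v) (by fun_prop)]
  have : ∀ x, (gaussianPDF 0 v * fun x => ENNReal.ofReal (Real.exp (x ^ 2 / (4 * v)))) x =
      ENNReal.ofReal (Real.sqrt 2) * ENNReal.ofReal (gaussianPDFReal 0 (2 * v) x) := by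
    intro x
    rw [Pi.mul_apply, gaussianPDF, ← ENNReal.ofReal_mul (gaussianPDFReal_nonneg _ _ _),
      ← ENNReal.ofReal_mul (Real.sqrt_nonneg _)]
    congr 1
    simp only [gaussianPDFReal, sub_zero, NNReal.coe_mul, NNReal.coe_ofNat]
    rw [mul_assoc, ← Real.exp_add, ← mul_assoc]
    congr 1
    · rw [show 2 * Real.pi * (2 * (v : ℝ)) = 2 * (2 * Real.pi * v) by ring,
        Real.sqrt_mul (by norm_num : (0 : ℝ) ≤ 2), mul_inv, ← mul_assoc,
        mul_inv_cancel₀ (by positivity), one_mul]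
    · congr 1
      field_simp
      ring
  simp_rw [this]
  rw [lintegral_const_mul _ (by fun_prop), lintegral_gaussianPDFReal_eq_one _ (by simpa using hv),
    mul_one]

theorem lintegral_sq_gaussianReal (v : ℝ≥0) :
    ∫⁻ x, ENNReal.ofReal (x ^ 2) ∂(gaussianReal 0 v) = v := by
  have h := variance_fun_id_gaussianReal (μ := 0) (v := v)
  have hi : Integrable (fun x : ℝ => x ^ 2) (gaussianReal 0 v) :=
    (memLp_id_gaussianReal (μ := 0) (v := v) 2).integrable_sq
  rw [← ofReal_integral_eq_lintegral_ofReal hi (ae_of_all _ fun x => sq_nonneg x)]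
  rw [variance_eq_integral (by fun_prop)] at h
  simp only [integral_id_gaussianReal, sub_zero] at h
  rw [h]
  simp

theorem lintegral_sum_sq_noise (n : ℕ) (σ : ℝ) :
    ∫⁻ e, ENNReal.ofReal (∑ i, e i ^ 2) ∂(noise n σ) = ENNReal.ofReal (n * σ ^ 2) := by
  have h1 : ∀ e : Fin n → ℝ, ENNReal.ofReal (∑ i, e i ^ 2) = ∑ i, ENNReal.ofReal (e i ^ 2) :=
    fun e => ENNReal.ofReal_sum_of_nonneg fun i _ => sq_nonneg _
  simp_rw [h1]
  rw [lintegral_finsetSum _ (by fun_prop)]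
  have h2 : ∀ i, ∫⁻ e, ENNReal.ofReal (e i ^ 2) ∂(noise n σ) = ENNReal.ofReal (σ ^ 2) := by
    intro i
    have := (measurePreserving_eval
      (fun _ : Fin n => gaussianReal 0 (Real.toNNReal (σ ^ 2))) i).lintegral_comp
      (f := fun x => ENNReal.ofReal (x ^ 2)) (by fun_prop)
    rw [lintegral_sq_gaussianReal] at this
    exact this
  simp_rw [h2]
  rw [Finset.sum_const, Finset.card_univ, Fintype.card_fin, nsmul_eq_mul,
    ENNReal.ofReal_mul (by positivity), ENNReal.ofReal_natCast]

/-- Sums of `k ≤ m` errors have a square-exponential moment at scale `4 m σ²`. -/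
theorem lintegral_exp_sq_sum_le {n : ℕ} {σ : ℝ} (hσ : 0 < σ) {A : Finset (Fin n)}
    (hA : A.Nonempty) {m : ℝ} (hm : A.card ≤ m) :
    ∫⁻ e, ENNReal.ofReal (Real.exp ((∑ j ∈ A, e j) ^ 2 / (4 * m * σ ^ 2))) ∂(noise n σ) ≤
      ENNReal.ofReal (Real.sqrt 2) := by
  have hc : (0 : ℝ) < A.card := by exact_mod_cast hA.card_pos
  have hv : (A.card * Real.toNNReal (σ ^ 2) : ℝ≥0) ≠ 0 := by
    have : 0 < Real.toNNReal (σ ^ 2) := Real.toNNReal_pos.2 (by positivity)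
    have := hA.card_pos
    positivity
  have hv' : ((A.card * Real.toNNReal (σ ^ 2) : ℝ≥0) : ℝ) = A.card * σ ^ 2 := by
    rw [NNReal.coe_mul, NNReal.coe_natCast, Real.coe_toNNReal _ (sq_nonneg _)]
  rw [← lintegral_exp_sq_gaussianReal hv, ← map_sum_pi_gaussianReal,
    lintegral_map (by fun_prop) (by fun_prop)]
  refine lintegral_mono fun e => ENNReal.ofReal_le_ofReal (Real.exp_le_exp.2 ?_)
  rw [hv', mul_assoc]
  gcongr

/-- A square is at most a logarithm plus a normalized exponential. -/
theorem sq_le_log_add_exp {n : ℕ} (hn : 0 < n) {a : ℝ} (ha : 0 < a) (x : ℝ) :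
    x ^ 2 ≤ a * (Real.log n - 1 + 1 / n * Real.exp (x ^ 2 / a)) := by
  have hn' : (0 : ℝ) < n := by exact_mod_cast hn
  have h1 := Real.add_one_le_exp (x ^ 2 / a - Real.log n)
  rw [Real.exp_sub, Real.exp_log hn'] at h1
  have h2 : x ^ 2 = a * (x ^ 2 / a) := by field_simp
  rw [h2]
  refine mul_le_mul_of_nonneg_left ?_ ha.le
  rw [← h2, one_div_mul_eq_div]
  linarith

namespace RootedTree

variable {n : ℕ}

/-- The largest squared path sum has expectation at most `16 h σ² log n`. -/
theorem lintegral_sup_pathSum_sq_le (T : RootedTree n) (hn : 2 ≤ n) {σ : ℝ} (hσ : 0 < σ) :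
    ∫⁻ e, ENNReal.ofReal (‖T.pathSum e‖ ^ 2) ∂(noise n σ) ≤
      ENNReal.ofReal (16 * T.height * σ ^ 2 * Real.log n) := by
  have hn0 : (0 : ℝ) < n := by positivity
  have hh : (1 : ℝ) ≤ T.height := by exact_mod_cast T.height_pos hn
  have hlog2 : Real.log 2 ≤ Real.log n := Real.log_le_log (by norm_num) (by exact_mod_cast hn)
  have hlog := Real.log_two_gt_d9
  -- Paths have at most `h + 1 ≤ 2h` nodes.
  set a : ℝ := 4 * (2 * T.height) * σ ^ 2 with ha
  have ha0 : 0 < a := by positivity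
  have hc0 : 0 ≤ a * (Real.log n - 1 + 1 / 2) := mul_nonneg ha0.le (by linarith)
  have hexp : ∀ i, ∫⁻ e, ENNReal.ofReal (Real.exp (T.pathSum e i ^ 2 / a)) ∂(noise n σ) ≤
      ENNReal.ofReal (Real.sqrt 2) := by
    intro i
    refine lintegral_exp_sq_sum_le hσ (Finset.card_pos.1 (by rw [card_ancestors]; omega)) ?_
    have h1 := T.depth_le_height i
    have h2 := T.height_pos hn
    rw [card_ancestors]
    exact_mod_cast (by omega : T.depth i + 1 ≤ 2 * T.height)
  -- For `n = 2`, `log n - 1` is negative and `ENNReal.ofReal` would truncate it. Adding `a / 2` to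
  -- both sides prevents this, as `log 2 > 1/2`; it is cancelled at the end.
  have hpt : ∀ e : Fin n → ℝ, ENNReal.ofReal (‖T.pathSum e‖ ^ 2) + ENNReal.ofReal (a * (1 / 2)) ≤
      ENNReal.ofReal (a * (Real.log n - 1 + 1 / 2)) +
        ENNReal.ofReal (a * (1 / n)) * ∑ i, ENNReal.ofReal (Real.exp (T.pathSum e i ^ 2 / a)) := by
    intro e
    have : Nonempty (Fin n) := ⟨T.root⟩
    obtain ⟨m, hm⟩ := Finite.exists_max fun i => ‖T.pathSum e i‖
    have hnorm : ‖T.pathSum e‖ ≤ ‖T.pathSum e m‖ := (pi_norm_le_iff_of_nonneg (norm_nonneg _)).2 hm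
    have h1 : ‖T.pathSum e‖ ^ 2 ≤ T.pathSum e m ^ 2 := by
      rw [← sq_abs (T.pathSum e m), ← Real.norm_eq_abs]
      gcongr
    have h2 := sq_le_log_add_exp (n := n) (by omega) ha0 (T.pathSum e m)
    have h3 : Real.exp (T.pathSum e m ^ 2 / a) ≤ ∑ i, Real.exp (T.pathSum e i ^ 2 / a) :=
      Finset.single_le_sum (f := fun i => Real.exp (T.pathSum e i ^ 2 / a))
        (fun i _ => (Real.exp_pos _).le) (Finset.mem_univ m)
    rw [← ENNReal.ofReal_sum_of_nonneg fun i _ => (Real.exp_pos _).le,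
      ← ENNReal.ofReal_mul (by positivity), ← ENNReal.ofReal_add hc0 (by positivity),
      ← ENNReal.ofReal_add (by positivity) (by positivity)]
    refine ENNReal.ofReal_le_ofReal ?_
    have h4 := mul_le_mul_of_nonneg_left h3 (by positivity : 0 ≤ a * (1 / n))
    nlinarith
  have hint : ∫⁻ e, ENNReal.ofReal (‖T.pathSum e‖ ^ 2) ∂(noise n σ) + ENNReal.ofReal (a * (1 / 2))
      ≤ ENNReal.ofReal (a * (Real.log n - 1 + 1 / 2) + a * Real.sqrt 2) := by
    have hmeas : ∀ i, Measurable fun e : Fin n → ℝ => T.pathSum e i := fun i => by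
      unfold pathSum; fun_prop
    calc _ = ∫⁻ e, (ENNReal.ofReal (‖T.pathSum e‖ ^ 2) + ENNReal.ofReal (a * (1 / 2)))
          ∂(noise n σ) := by
          rw [lintegral_add_right _ measurable_const, lintegral_const, measure_univ, mul_one]
      _ ≤ _ := lintegral_mono hpt
      _ = ENNReal.ofReal (a * (Real.log n - 1 + 1 / 2)) + ENNReal.ofReal (a * (1 / n)) *
          ∑ i, ∫⁻ e, ENNReal.ofReal (Real.exp (T.pathSum e i ^ 2 / a)) ∂(noise n σ) := by
          rw [lintegral_add_left measurable_const, lintegral_const, measure_univ, mul_one,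
            lintegral_const_mul _ (by fun_prop), lintegral_finsetSum _ (by fun_prop)]
      _ ≤ ENNReal.ofReal (a * (Real.log n - 1 + 1 / 2)) + ENNReal.ofReal (a * (1 / n)) *
          ∑ _i : Fin n, ENNReal.ofReal (Real.sqrt 2) := by
          gcongr with i
          exact hexp i
      _ = _ := by
          rw [Finset.sum_const, Finset.card_univ, Fintype.card_fin, nsmul_eq_mul,
            ← ENNReal.ofReal_natCast n, ← ENNReal.ofReal_mul (by positivity),
            ← ENNReal.ofReal_mul (by positivity), ← ENNReal.ofReal_add hc0 (by positivity)]
          congr 2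
          field_simp
  have hs2 : Real.sqrt 2 ≤ 3 / 2 := by
    rw [Real.sqrt_le_left (by norm_num)]
    norm_num
  have hfin : a * (Real.log n - 1 + 1 / 2) + a * Real.sqrt 2 ≤
      16 * T.height * σ ^ 2 * Real.log n + a * (1 / 2) := by
    have : 16 * T.height * σ ^ 2 * Real.log n = a * (2 * Real.log n) := by rw [ha]; ring
    rw [this, ← mul_add, ← mul_add]
    exact mul_le_mul_of_nonneg_left (by linarith) ha0.le
  have := hint.trans (ENNReal.ofReal_le_ofReal hfin)
  rw [ENNReal.ofReal_add (mul_nonneg (by positivity) (by linarith)) (by positivity)] at this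
  exact (ENNReal.add_le_add_iff_right ENNReal.ofReal_ne_top).1 this

end RootedTree

end TreeFlow

/-! ### Tall and short trees, and the risk bounds -/

namespace TreeFlow

/-- For tall trees, the noise level per node is dominated by `h² log (n / h)`. -/
theorem le_four_mul_sq_mul_log {n h : ℝ} (h1 : 1 ≤ h) (hsucc : h + 1 ≤ n) (hsq : n ≤ h ^ 2) :
    n ≤ 4 * (h ^ 2 * Real.log (n / h)) := by
  have hn : 0 < n := by linarith
  have hlog := Real.one_sub_inv_le_log_of_pos (x := n / h) (by positivity)
  rw [inv_div] at hlog
  have h2 : h ^ 2 * (1 - h / n) ≤ h ^ 2 * Real.log (n / h) := by gcongr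
  have h3 : n ≤ 4 * (h ^ 2 * (1 - h / n)) := by
    have : 4 * (h ^ 2 * (1 - h / n)) = 4 * h ^ 2 * (n - h) / n := by field_simp
    rw [this, le_div_iff₀ hn]
    -- The goal amounts to `n² ≤ 4h²(n - h)`: either `n - h ≥ n / 2` and `h² ≥ n`, or `n ≤ 2h` and
    -- `n - h ≥ 1`.
    rcases le_total (2 * h) n with hc | hc
    · nlinarith
    · nlinarith
  linarith

/-- For short trees, `log n` is comparable to `log (n / h)`. -/
theorem mul_log_le_two_mul_sq_mul_log {n h : ℝ} (h1 : 1 ≤ h) (hsq : h ^ 2 ≤ n) :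
    h * Real.log n ≤ 2 * (h ^ 2 * Real.log (n / h)) := by
  have hn : 1 ≤ n := by nlinarith
  have hlog : 2 * Real.log h ≤ Real.log n := by
    have := Real.log_le_log (by positivity) hsq
    rwa [Real.log_pow] at this
  have h0 := Real.log_nonneg hn
  rw [Real.log_div (by linarith) (by linarith)]
  have h2 : h ^ 2 * Real.log n ≤ h ^ 2 * (2 * (Real.log n - Real.log h)) := by
    gcongr
    linarith
  have h3 : h * Real.log n ≤ h ^ 2 * Real.log n := by
    gcongr
    nlinarith
  linarith

theorem risk_le_of_lintegral_le {n : ℕ} {σ : ℝ}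
    {est : EuclideanSpace ℝ (Fin n) → EuclideanSpace ℝ (Fin n)} {μ : EuclideanSpace ℝ (Fin n)}
    {B : ℝ} (hB : ∫⁻ e, ENNReal.ofReal (‖est (μ + WithLp.toLp 2 e) - μ‖ ^ 2) ∂(noise n σ) ≤
      ENNReal.ofReal B) :
    risk σ est μ ≤ ENNReal.ofReal (1 / n * B) := by
  have hn : (0 : ℝ) ≤ 1 / n := by positivity
  unfold risk
  simp_rw [ENNReal.ofReal_mul hn]
  -- The constant is finite, so no measurability of `est` is needed.
  rw [lintegral_const_mul' _ _ ENNReal.ofReal_ne_top]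
  gcongr

namespace RootedTree

variable {n : ℕ}

/-- The estimation error never exceeds the noise. -/
theorem risk_lse_le (T : RootedTree n) (σ : ℝ) {μ : EuclideanSpace ℝ (Fin n)} (hμ : μ ∈ T.flows) :
    risk σ T.lse μ ≤ ENNReal.ofReal (1 / n * (n * σ ^ 2)) := by
  refine risk_le_of_lintegral_le ?_
  rw [← lintegral_sum_sq_noise]
  exact lintegral_mono fun e => ENNReal.ofReal_le_ofReal (T.norm_sq_lse_sub_le_sum_sq hμ e)

/-- The bound through path sums, with a free parameter `t`. -/
theorem risk_lse_le_of_height (T : RootedTree n) (hn : 2 ≤ n) {σ V t : ℝ} (hσ : 0 < σ)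
    (hV : 0 ≤ V) (ht : 0 < t) {μ : EuclideanSpace ℝ (Fin n)} (hμ : μ ∈ T.flows)
    (hμV : μ T.root ≤ V) :
    risk σ T.lse μ ≤ ENNReal.ofReal
      (1 / n * ((2 * V / t + 1) * (16 * T.height * σ ^ 2 * Real.log n) + 2 * V * t)) := by
  have hlog : 0 ≤ Real.log n := Real.log_natCast_nonneg n
  refine risk_le_of_lintegral_le ?_
  have hpt : ∀ e : Fin n → ℝ,
      ENNReal.ofReal (‖T.lse (μ + WithLp.toLp 2 e) - μ‖ ^ 2) ≤
        ENNReal.ofReal (2 * V / t + 1) * ENNReal.ofReal (‖T.pathSum e‖ ^ 2) +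
          ENNReal.ofReal (2 * V * t) := by
    intro e
    rw [← ENNReal.ofReal_mul (by positivity), ← ENNReal.ofReal_add (by positivity) (by positivity)]
    refine ENNReal.ofReal_le_ofReal ((T.norm_sq_lse_sub_le_of_pathSum hμ hμV e
      (M := ‖T.pathSum e‖) fun i => norm_le_pi_norm (T.pathSum e) i).trans ?_)
    set M := ‖T.pathSum e‖
    -- Linearizing `M` leaves only its second moment to be bounded.
    have h1 : 2 * M ≤ M ^ 2 / t + t := by
      rw [← sub_nonneg, show M ^ 2 / t + t - 2 * M = (M - t) ^ 2 / t by field_simp; ring]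
      positivity
    have h2 := mul_le_mul_of_nonneg_left h1 (by positivity : 0 ≤ 2 * V)
    have h3 : (2 * V / t + 1) * M ^ 2 + 2 * V * t = 2 * V * (M ^ 2 / t + t) + M ^ 2 := by ring
    linarith
  refine (lintegral_mono hpt).trans ?_
  rw [lintegral_add_right _ measurable_const, lintegral_const, measure_univ, mul_one,
    lintegral_const_mul' _ _ ENNReal.ofReal_ne_top,
    ENNReal.ofReal_add (q := 2 * V * t) (by positivity) (by positivity),
    ENNReal.ofReal_mul (p := 2 * V / t + 1) (by positivity)]
  gcongr
  exact T.lintegral_sup_pathSum_sq_le hn hσ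

end RootedTree

end TreeFlow

theorem mainTheorem1 :
    ∃ C : ℝ, 0 < C ∧
      ∀ (n : ℕ) (_ : 2 ≤ n) (T : TreeFlow.RootedTree n) (σ V : ℝ) (_ : 0 ≤ σ) (_ : 0 ≤ V),
        (⨆ μ ∈ {μ : EuclideanSpace ℝ (Fin n) | μ ∈ T.flows ∧ μ T.root ≤ V},
            TreeFlow.risk σ T.lse μ) ≤
          ENNReal.ofReal (C * (1 / (n : ℝ)) *
            (σ ^ 2 * (T.height : ℝ) ^ 2 * Real.log ((n : ℝ) / (T.height : ℝ)) +
              (T.height : ℝ) * V * σ * Real.sqrt (Real.log ((n : ℝ) / (T.height : ℝ))))) := by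
  refine ⟨66, by norm_num, fun n hn T σ V hσ hV => iSup₂_le fun μ ⟨hμ, hμV⟩ => ?_⟩
  have hn0 : (0 : ℝ) < n := by positivity
  have h1 : (1 : ℝ) ≤ T.height := by exact_mod_cast T.height_pos hn
  have hlt : (T.height : ℝ) + 1 ≤ n := by exact_mod_cast T.height_lt
  set h : ℝ := (T.height : ℝ)
  set L : ℝ := Real.log (n / h)
  have hL : 0 < L := Real.log_pos ((one_lt_div (by linarith : 0 < h)).2 (by linarith))
  -- `σ = 0` goes with the crude bound, since the other branch needs `t > 0`.
  by_cases hcase : σ = 0 ∨ (n : ℝ) ≤ h ^ 2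
  · refine (T.risk_lse_le σ hμ).trans (ENNReal.ofReal_le_ofReal ?_)
    rw [mul_comm (66 : ℝ), mul_assoc (1 / (n : ℝ))]
    refine mul_le_mul_of_nonneg_left ?_ (by positivity)
    have h2 : 0 ≤ h * V * σ * Real.sqrt L := by positivity
    rcases hcase with rfl | hsq
    · simp
    · have h3 := mul_le_mul_of_nonneg_right (TreeFlow.le_four_mul_sq_mul_log h1 hlt hsq)
        (sq_nonneg σ)
      have h4 : 0 ≤ σ ^ 2 * h ^ 2 * L := by positivity
      linarith
  · push Not at hcase
    have hσ' : 0 < σ := lt_of_le_of_ne hσ (Ne.symm hcase.1)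
    -- With this `t`, the two target terms are `t²` and `V * t`. The constant 66 is `2 * 32 + 2`,
    -- the coefficient of `V * t`.
    set t : ℝ := h * σ * Real.sqrt L with ht
    have ht0 : 0 < t := by positivity
    have ht2 : t ^ 2 = σ ^ 2 * h ^ 2 * L := by
      rw [ht, mul_pow, Real.sq_sqrt hL.le]
      ring
    refine (T.risk_lse_le_of_height hn hσ' hV ht0 hμ hμV).trans (ENNReal.ofReal_le_ofReal ?_)
    rw [mul_comm (66 : ℝ), mul_assoc (1 / (n : ℝ))]
    refine mul_le_mul_of_nonneg_left ?_ (by positivity)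
    have h2 : 16 * h * σ ^ 2 * Real.log n ≤ 32 * t ^ 2 := by
      have := mul_le_mul_of_nonneg_left
        (TreeFlow.mul_log_le_two_mul_sq_mul_log h1 hcase.2.le)
        (by positivity : (0 : ℝ) ≤ 16 * σ ^ 2)
      rw [ht2]
      linarith
    calc (2 * V / t + 1) * (16 * h * σ ^ 2 * Real.log n) + 2 * V * t
        ≤ (2 * V / t + 1) * (32 * t ^ 2) + 2 * V * t := by gcongr
      _ = 32 * t ^ 2 + 66 * (V * t) := by field_simp; ring
      _ ≤ 66 * (t ^ 2 + V * t) := by nlinarith [sq_nonneg t]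
      _ = 66 * (σ ^ 2 * h ^ 2 * L + h * V * σ * Real.sqrt L) := by rw [ht2, ht]; ring
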